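/- Let $X=G/P$, where $G$ is a connected, simply connected, simple complex Lie group and $P\supset B\supset T$ is a parabolic subgroup, and let $R$ be the root system, $R^+$ the positive roots, $\Delta$ the simple roots, $W$ the Weyl group, with length $\ell(w)=|I(w)|$, $I(w)=\{\alpha\in R^+: w(\alpha)<0\}$. The group $P$ corresponds to a set $\Delta_P\subset\Delta$; let $W_P=\langle s_\beta:\beta\in\Delta_P\rangle$, let $w_P$ be its longest element, $R_P^+=R^+\cap\mathbb Z\Delta_P$, and let $W^P=\{w\in W: I(w)\cap R_P^+=\emptyset\}$ be the set of minimal representatives of the cosets in $W/W_P$. Identify $H_2(X)=\mathbb Z\Delta^\vee/\mathbb Z\Delta_P^\vee$, ordered by $d\le e$ if $e-d$ is a non-negative integer combination of the classes of simple coroots; $d$ is effective if $d\ge 0$. For roots, $\alpha\le\beta$ means that $\beta-\alpha$ is a non-negative combination of simple roots. The Hecke product on $W$ is $u\cdot v=u\cdot s_{\beta_1}\cdot\ldots\cdot s_{\beta_\ell}$ (multiplied from left to right) for any reduced expression $v=s_{\beta_1}\cdots s_{\beta_\ell}$ in simple reflections, where $u\cdot s_\beta=us_\beta$ if $\ell(us_\beta)>\ell(u)$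 and $u\cdot s_\beta=u$ otherwise. For $d\in H_2(X)$, a maximal root of $d$ is a maximal element of $\{\alpha\in R^+\smallsetminus R_P^+:\alpha^\vee+\mathbb Z\Delta_P^\vee\le d\}$. A root $\alpha\in R^+\smallsetminus R_P^+$ is $P$-cosmall if it is a maximal root of $\alpha^\vee+\mathbb Z\Delta_P^\vee$. A greedy decomposition of $d$ is a sequence $(\alpha_1,\dots,\alpha_k)$ such that $\alpha_1$ is a maximal root of $d$ and $(\alpha_2,\dots,\alpha_k)$ is a greedy decomposition of $d-\alpha_1^\vee$; the empty sequence is a greedy decomposition of $0$. For effective $d$, $z_d^P\in W^P$ is the element with $z_d^Pw_P=s_{\alpha_1}\cdot\ldots\cdot s_{\alpha_k}\cdot w_P$ (Hecke product) for a greedy decomposition $(\alpha_1,\dots,\alpha_k)$ of $d$. Theorem. Assume that $X=G/P$ is cominuscule, that is, $\Delta_P=\Delta\smallsetminus\{\gamma\}$ for a simple root $\gamma$ whose coefficient in the highest root of $R$ is one. Then $H_2(X)\cong\mathbb Z$ is freely generated by $\gamma^\vee+\mathbb Z\Delta_P^\vee$, and the effective degrees correspond to the integers $d\ge 0$. The highest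 root of $R$ is the one and only $P$-cosmall root. For every integer $d\ge 0$ the element $z_d^P$ exists and is independent of the greedy decomposition, and $$z_d^P W_P=(w_Ps_\gamma)\cdot(w_Ps_\gamma)\cdot\ldots\cdot(w_Ps_\gamma)\,W_P,$$ where the Hecke product has $d$ factors (and is $1$ for $d=0$). -/

import Mathlib

/-! Curve neighborhoods of a point in `G/P`, described through the root system `R` of `G`.

A root system `R` in `ℝΔ` is a finite reduced crystallographic root system
`P : RootPairing ι ℝ M N` (roots are indexed by `ι`), with simple roots `Δ` given by `b : P.Base`.
A parabolic subgroup containing the Borel subgroup corresponds to a set `J` of simple roots,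
the set `Δ_P`. -/

noncomputable section

namespace CurveNbhd

open RootPairing

section Defs

variable {ι M N : Type*} [AddCommGroup M] [Module ℝ M] [AddCommGroup N] [Module ℝ N]
variable {P : RootPairing ι ℝ M N}

/-! ### Orders on roots, and degrees -/

/-- The partial order `α ≤ β` on roots: `β - α` is a combination of simple roots with non-negative
coefficients. (Differences of roots are integral combinations of the linearly independent simple
roots, so it does not matter whether the coefficients are taken in `ℝ` or in `ℕ`.) -/
def RootLE (b : P.Base) (i j : ι) : Prop :=
  P.root j - P.root i ∈ AddSubmonoid.closure (P.root '' b.support)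

/-- The highest root: the positive root that is at least as large as every root. -/
def IsHighestRoot (b : P.Base) (θ : ι) : Prop :=
  b.IsPos θ ∧ ∀ i, RootLE b i θ

/-- A simple root `γ` is cominuscule if its coefficient is one when the highest root is
written as a linear combination of simple roots. -/
def IsCominuscule [P.IsRootSystem] (b : P.Base) (γ : b.support) : Prop :=
  ∃ θ, IsHighestRoot b θ ∧ b.toWeightBasis.repr (P.root θ) γ = 1

/-- `R_P⁺ = R⁺ ∩ ℤΔ_P`. -/
def posRootsOf (b : P.Base) (J : Set ι) : Set ι :=
  {i | b.IsPos i ∧ P.root i ∈ AddSubgroup.closure (P.root '' J)}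

/-- The coroot lattice `ℤΔ^∨`. -/
def corootLattice (b : P.Base) : AddSubgroup N :=
  AddSubgroup.closure (P.coroot '' b.support)

/-- `H₂(X) = ℤΔ^∨ / ℤΔ_P^∨`. -/
abbrev H2 (b : P.Base) (J : Set ι) : Type _ :=
  corootLattice b ⧸ (AddSubgroup.closure (P.coroot '' J)).addSubgroupOf (corootLattice b)

theorem coroot_mem_corootLattice (b : P.Base) (i : ι) : P.coroot i ∈ corootLattice b := by
  have h := b.coroot_mem_span_int i
  rw [← Submodule.mem_toAddSubgroup, Submodule.span_int_eq_addSubgroupClosure] at h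
  exact h

/-- The class `α^∨ + ℤΔ_P^∨` in `H₂(X)`. -/
def corootClass (b : P.Base) (J : Set ι) (i : ι) : H2 b J :=
  QuotientAddGroup.mk ⟨P.coroot i, coroot_mem_corootLattice b i⟩

/-- A degree is effective, `0 ≤ d`, if it is a combination of the classes of the simple coroots with
non-negative integer coefficients. -/
def IsEffective (b : P.Base) (J : Set ι) (d : H2 b J) : Prop :=
  d ∈ AddSubmonoid.closure (corootClass b J '' b.support)

/-- The partial order `d ≤ e` on `H₂(X)`. -/
def DegreeLE (b : P.Base) (J : Set ι) (d e : H2 b J) : Prop :=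
  IsEffective b J (e - d)

/-- The roots `α ∈ R⁺ ∖ R_P⁺` with `α^∨ + ℤΔ_P^∨ ≤ d`. -/
def rootsBelow (b : P.Base) (J : Set ι) (d : H2 b J) : Set ι :=
  {i | b.IsPos i ∧ i ∉ posRootsOf b J ∧ DegreeLE b J (corootClass b J i) d}

/-- `α` is a maximal root of the degree `d`: a maximal element of `rootsBelow b J d`. -/
def IsMaximalRoot (b : P.Base) (J : Set ι) (d : H2 b J) (i : ι) : Prop :=
  i ∈ rootsBelow b J d ∧ ∀ j ∈ rootsBelow b J d, RootLE b i j → j = i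

/-- `α ∈ R⁺ ∖ R_P⁺` is `P`-cosmall if it is a maximal root of `α^∨ + ℤΔ_P^∨`. -/
def IsPCosmall (b : P.Base) (J : Set ι) (i : ι) : Prop :=
  IsMaximalRoot b J (corootClass b J i) i

/-- Greedy decompositions of a degree. -/
inductive IsGreedyDecomposition (b : P.Base) (J : Set ι) : H2 b J → List ι → Prop
  | nil : IsGreedyDecomposition b J 0 []
  | cons {d : H2 b J} {i : ι} {l : List ι} (hi : IsMaximalRoot b J d i)
      (hl : IsGreedyDecomposition b J (d - corootClass b J i) l) :
      IsGreedyDecomposition b J d (i :: l)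

/-! ### The Weyl group and the Hecke product -/

/-- The reflection `s_α` as an element of the Weyl group `W`. -/
abbrev refl (P : RootPairing ι ℝ M N) (i : ι) : P.weylGroup := weylGroup.ofIdx P i

/-- The inversion set `I(w) = {α ∈ R⁺ | w(α) < 0}`. -/
def inversions (b : P.Base) (w : P.weylGroup) : Set ι :=
  {i | b.IsPos i ∧ ¬ b.IsPos (P.weylGroupToPerm w i)}

/-- The length `ℓ(w) = |I(w)|`. -/
def length (b : P.Base) (w : P.weylGroup) : ℕ := (inversions b w).ncard

/-- The element of `W` spelled by a word in the simple reflections. -/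
def wordProd (b : P.Base) (l : List b.support) : P.weylGroup :=
  (l.map fun i => refl P i).prod

/-- `l` is a reduced expression for `w`. -/
def IsReducedExpr (b : P.Base) (w : P.weylGroup) (l : List b.support) : Prop :=
  wordProd b l = w ∧ ∀ l', wordProd b l' = w → l.length ≤ l'.length

theorem refl_reflectionPerm (i j : ι) :
    refl P (P.reflectionPerm j i) = refl P j * refl P i * refl P j := by
  apply Subtype.ext
  refine RootPairing.Equiv.ext ?_ ?_ ?_
  · ext x
    exact congrArg (fun f : M ≃ₗ[ℝ] M => f x) (P.reflection_reflectionPerm (i := i) (j := j))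
  · ext x
    exact congrArg (fun f : N ≃ₗ[ℝ] N => f x) (P.flip.reflection_reflectionPerm (i := i) (j := j))
  · ext k
    have h := congrArg (fun f : M ≃ₗ[ℝ] M => f (P.root k))
      (P.reflection_reflectionPerm (i := i) (j := j))
    apply P.root.injective
    simp only [LinearEquiv.mul_apply, ← P.root_reflectionPerm] at h
    exact h

theorem refl_mul_self (i : ι) : refl P i * refl P i = 1 := by
  apply Subtype.ext
  have h : (RootPairing.Equiv.reflection P i)⁻¹ = RootPairing.Equiv.reflection P i :=
    RootPairing.Equiv.reflection_inv P i
  have h' := mul_inv_cancel (RootPairing.Equiv.reflection P i)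
  rw [h] at h'
  exact h'

theorem exists_isReducedExpr [Finite ι] [P.IsCrystallographic] [P.IsReduced]
    (b : P.Base) (w : P.weylGroup) : ∃ l, IsReducedExpr b w l := by
  have hrefl : ∀ i, ∃ l, wordProd b l = refl P i := by
    intro i
    refine b.induction_reflect i (p := fun i => ∃ l, wordProd b l = refl P i) ?_ ?_ ?_
    · rintro i ⟨l, hl⟩
      refine ⟨l, ?_⟩
      rw [hl, refl_reflectionPerm, refl_mul_self, one_mul]
    · intro i hi
      exact ⟨[⟨i, hi⟩], by simp [wordProd]⟩
    · rintro i j ⟨l, hl⟩ hj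
      refine ⟨⟨j, hj⟩ :: (l ++ [⟨j, hj⟩]), ?_⟩
      rw [refl_reflectionPerm, ← hl]
      simp [wordProd, mul_assoc]
  have hw : ∃ l, wordProd b l = w := by
    obtain ⟨w, hw⟩ := w
    induction hw using weylGroup.induction with
    | mem i => exact hrefl i
    | one => exact ⟨[], rfl⟩
    | mul x y hx hy h₁ h₂ =>
      obtain ⟨l₁, h₁⟩ := h₁
      obtain ⟨l₂, h₂⟩ := h₂
      refine ⟨l₁ ++ l₂, ?_⟩
      have : wordProd b (l₁ ++ l₂) = wordProd b l₁ * wordProd b l₂ := by simp [wordProd]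
      rw [this, h₁, h₂]
      rfl
  classical
  have hn : ∃ n l, wordProd b l = w ∧ l.length = n := hw.elim fun l hl => ⟨_, l, hl, rfl⟩
  obtain ⟨l, hl, hlen⟩ := Nat.find_spec hn
  exact ⟨l, hl, fun l' hl' => hlen ▸ Nat.find_min' hn ⟨l', hl', rfl⟩⟩

open Classical in
/-- `u · s_β` for a simple root `β`. -/
def heckeSimple (b : P.Base) (u : P.weylGroup) (β : b.support) : P.weylGroup :=
  if length b u < length b (u * refl P β) then u * refl P β else u

/-- The Hecke product `u · v`: multiply `u` successively by the simple reflections of a reduced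
expression for `v`. -/
def hecke [Finite ι] [P.IsCrystallographic] [P.IsReduced] (b : P.Base)
    (u v : P.weylGroup) : P.weylGroup :=
  (exists_isReducedExpr b v).choose.foldl (heckeSimple b) u

/-- The Hecke product `x · x · … · x` with `n` factors. -/
def heckePow [Finite ι] [P.IsCrystallographic] [P.IsReduced] (b : P.Base)
    (x : P.weylGroup) : ℕ → P.weylGroup
  | 0 => 1
  | n + 1 => hecke b (heckePow b x n) x

/-! ### Parabolic subgroups of the Weyl group and the elements `z_d^P` -/

/-- `W_P`, generated by the reflections `s_β` for `β ∈ Δ_P`. -/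
def parabolic (P : RootPairing ι ℝ M N) (J : Set ι) : Subgroup P.weylGroup :=
  Subgroup.closure (refl P '' J)

theorem exists_longest [Finite ι] (b : P.Base) (J : Set ι) :
    ∃ w ∈ parabolic P J, ∀ v ∈ parabolic P J, length b v ≤ length b w := by
  have hb : BddAbove (length b '' (parabolic P J : Set P.weylGroup)) := by
    refine ⟨Nat.card ι, ?_⟩
    rintro - ⟨w, -, rfl⟩
    exact Set.ncard_le_card _
  have hne : (length b '' (parabolic P J : Set P.weylGroup)).Nonempty :=
    ⟨length b 1, 1, one_mem _, rfl⟩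
  obtain ⟨w, hw, h⟩ := Nat.sSup_mem hne hb
  exact ⟨w, hw, fun v hv => h ▸ le_csSup hb ⟨v, hv, rfl⟩⟩

/-- `w_P`, the longest element of `W_P`. -/
def longest [Finite ι] (b : P.Base) (J : Set ι) : P.weylGroup :=
  (exists_longest b J).choose

/-- `W^P`, the set of minimal representatives of the cosets in `W / W_P`. -/
def minimalReps (b : P.Base) (J : Set ι) : Set P.weylGroup :=
  {w | inversions b w ∩ posRootsOf b J = ∅}

/-- `z` is the element `z_d^P`: it lies in `W^P`, and `z w_P = s_{α₁} · s_{α₂} · … · s_{αₖ} · w_P`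
for a greedy decomposition `(α₁, …, αₖ)` of `d`. -/
def IsZ [Finite ι] [P.IsCrystallographic] [P.IsReduced] (b : P.Base)
    (J : Set ι) (d : H2 b J) (z : P.weylGroup) : Prop :=
  z ∈ minimalReps b J ∧ ∃ l, IsGreedyDecomposition b J d l ∧
    z * longest b J = l.foldr (fun i v => hecke b (refl P i) v) (longest b J)

end Defs

end CurveNbhd

end

/-! Write p for w_P, θ for the highest root and a = p s_γ. Everything rests on p γ = θ
(`act_longest_eq`). Elements of W_P change a root only by ℤΔ_P, so p⁻¹θ has γ-coefficient one and
equals γ + y with y a non-negative combination of Δ_P. Since p makes Δ_P negative, θ = pγ + py ≤ pγ,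
and maximality of θ gives equality.

Two consequences follow. First, θ^∨ and γ^∨ have the same class, the generator of H₂(X). Every root
outside R_P⁺ has positive degree, so θ is the only maximal root of each degree d > 0, and (θ, …, θ)
with d entries is the only greedy decomposition (`isGreedyDecomposition_nsmul_iff`). Second, s_θ = p
s_γ p⁻¹, so s_θ and a lie in the same coset of W_P. As u · p depends only on uW_P
(`hecke_longest_congr`), s_θ · p = a · p. Together with p · a = a and p · p = p this turns s_θ · … ·
s_θ · p into a · … · a · p (`foldr_hecke_replicate`), which lies in the coset of a · … · a.

The Hecke product is defined through a chosen reduced word. Its associativity and independence of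
the word come from the fact that left and right simple Hecke products commute
(`heckeSimple_simpleHecke`), with no appeal to braid relations. -/

noncomputable section

namespace CurveNbhd

open RootPairing

/-! ### The Weyl group acting on roots, and the Hecke monoid. -/

section WeylHecke

variable {ι M N : Type*} [AddCommGroup M] [Module ℝ M] [AddCommGroup N] [Module ℝ N]
variable {P : RootPairing ι ℝ M N}

/-- The action of the Weyl group on the indices of the roots. -/
def act (w : P.weylGroup) (i : ι) : ι := P.weylGroupToPerm w i

theorem act_one (i : ι) : act (1 : P.weylGroup) i = i := by
  simp [act]

theorem act_mul (u v : P.weylGroup) (i : ι) : act (u * v) i = act u (act v i) := by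
  simp only [act, map_mul, Equiv.Perm.mul_apply]

theorem act_inv_act (u : P.weylGroup) (i : ι) : act u⁻¹ (act u i) = i := by
  rw [← act_mul, inv_mul_cancel, act_one]

theorem act_act_inv (u : P.weylGroup) (i : ι) : act u (act u⁻¹ i) = i := by
  rw [← act_mul, mul_inv_cancel, act_one]

theorem act_refl (i j : ι) : act (refl P j) i = P.reflectionPerm j i := rfl

theorem act_refl_refl (i j : ι) : act (refl P j) (act (refl P j) i) = i := by
  rw [← act_mul, refl_mul_self, act_one]

theorem eq_act_refl_self {i j : ι} (h : act (refl P j) i = j) : i = act (refl P j) j := by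
  rw [← act_refl_refl (P := P) i j, h]

theorem root_act (w : P.weylGroup) (i : ι) : P.root (act w i) = w • P.root i :=
  (weylGroup_apply_root P w i).symm

theorem root_act_refl_self (i : ι) : P.root (act (refl P i) i) = -P.root i := by
  rw [act_refl, root_reflectionPerm, reflection_apply_self]

theorem root_act_neg {i j : ι} (w : P.weylGroup) (h : P.root i = -P.root j) :
    P.root (act w i) = -P.root (act w j) := by
  rw [root_act, root_act, h, smul_neg]

theorem refl_inv (i : ι) : (refl P i)⁻¹ = refl P i :=
  inv_eq_of_mul_eq_one_left (refl_mul_self i)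

theorem mul_refl_mul_refl (u : P.weylGroup) (i : ι) : u * refl P i * refl P i = u := by
  rw [mul_assoc, refl_mul_self, mul_one]

theorem refl_act (w : P.weylGroup) (i : ι) : refl P (act w i) = w * refl P i * w⁻¹ := by
  obtain ⟨w, hw⟩ := w
  induction hw using weylGroup.induction generalizing i with
  | mem j =>
    have : (⟨_, P.reflection_mem_weylGroup j⟩ : P.weylGroup) = refl P j := rfl
    rw [this, act_refl, refl_reflectionPerm, refl_inv]
  | one =>
    have : (⟨1, one_mem _⟩ : P.weylGroup) = 1 := rfl
    rw [this, act_one]; simp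
  | mul x y hx hy h₁ h₂ =>
    have : (⟨x * y, mul_mem hx hy⟩ : P.weylGroup) = ⟨x, hx⟩ * ⟨y, hy⟩ := rfl
    rw [this, act_mul, h₁, h₂, mul_inv_rev]
    simp only [mul_assoc]

theorem wordProd_nil (b : P.Base) : wordProd b [] = 1 := rfl

theorem wordProd_cons (b : P.Base) (β : b.support) (l : List b.support) :
    wordProd b (β :: l) = refl P β * wordProd b l := by
  simp [wordProd]

theorem wordProd_append (b : P.Base) (l m : List b.support) :
    wordProd b (l ++ m) = wordProd b l * wordProd b m := by
  simp [wordProd]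

theorem wordProd_concat (b : P.Base) (l : List b.support) (β : b.support) :
    wordProd b (l ++ [β]) = wordProd b l * refl P β := by
  simp [wordProd]

/-! ### Positive roots -/

/-- The cone of simple roots is pointed: the height functional, equal to 1 on each simple root, is
positive on its non-zero elements. -/
theorem eq_zero_of_mem_closure_of_neg_mem {b : P.Base} [P.IsRootSystem] {x : M}
    (h : x ∈ AddSubmonoid.closure (P.root '' b.support))
    (h' : -x ∈ AddSubmonoid.closure (P.root '' b.support)) : x = 0 := by
  set f : M →ₗ[ℝ] ℝ := b.toWeightBasis.constr ℝ fun _ => (1 : ℝ) with hf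
  have key : ∀ y ∈ AddSubmonoid.closure (P.root '' b.support), y = 0 ∨ 0 < f y := by
    intro y hy
    induction hy using AddSubmonoid.closure_induction with
    | mem y hy =>
      obtain ⟨i, hi, rfl⟩ := hy
      right
      have := b.toWeightBasis.constr_basis ℝ (fun _ => (1 : ℝ)) ⟨i, hi⟩
      rw [Base.toWeightBasis_apply] at this
      rw [hf, this]
      exact one_pos
    | zero => exact Or.inl rfl
    | add y z _ _ hy hz =>
      rcases hy with rfl | hy
      · simpa using hz
      · right
        rcases hz with rfl | hz
        · simpa using hy
        · rw [map_add]; exact add_pos hy hz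
  rcases key x h with h₁ | h₁
  · exact h₁
  · rcases key (-x) h' with h₂ | h₂
    · exact neg_eq_zero.mp h₂
    · rw [map_neg] at h₂
      linarith

variable [Finite ι] [P.IsCrystallographic] [P.IsReduced]

omit [Finite ι] [P.IsCrystallographic] [P.IsReduced] in
theorem isPos_of_root_eq_neg {b : P.Base} {i j : ι} (h : P.root i = -P.root j) :
    b.IsPos i ↔ ¬ b.IsPos j := by
  let := P.indexNeg
  have : i = -j := P.root.injective (by simpa using h)
  rw [this, Base.IsPos.neg_iff_not]

omit [Finite ι] [P.IsCrystallographic] [P.IsReduced] in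
theorem isPos_act_refl_self {b : P.Base} (w : P.weylGroup) (i : ι) :
    b.IsPos (act w (act (refl P i) i)) ↔ ¬ b.IsPos (act w i) :=
  isPos_of_root_eq_neg (root_act_neg w (root_act_refl_self i))

omit [P.IsReduced] in
theorem root_mem_closure {b : P.Base} {i : ι} (h : b.IsPos i) :
    P.root i ∈ AddSubmonoid.closure (P.root '' b.support) := by
  refine h.induction_on_add
    (p := fun i => P.root i ∈ AddSubmonoid.closure (P.root '' b.support))
    (fun i hi => AddSubmonoid.subset_closure ⟨i, hi, rfl⟩) ?_
  intro i j k hk hi hj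
  rw [hk]
  exact add_mem hi (AddSubmonoid.subset_closure ⟨j, hj, rfl⟩)

omit [P.IsReduced] in
theorem neg_root_mem_closure {b : P.Base} {i : ι} (h : ¬ b.IsPos i) :
    -P.root i ∈ AddSubmonoid.closure (P.root '' b.support) := by
  rw [← root_act_refl_self]
  apply root_mem_closure
  exact (isPos_of_root_eq_neg (root_act_refl_self i)).mpr h

omit [P.IsReduced] in
theorem not_isPos_iff_neg_root_mem [P.IsRootSystem] {b : P.Base} {i : ι} :
    ¬ b.IsPos i ↔ -P.root i ∈ AddSubmonoid.closure (P.root '' b.support) := by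
  refine ⟨neg_root_mem_closure, fun h h' => ?_⟩
  exact P.ne_zero i (eq_zero_of_mem_closure_of_neg_mem (root_mem_closure h') h)

theorem isPos_act_refl {b : P.Base} {i : ι} {β : ι} (hβ : β ∈ b.support) (hi : b.IsPos i)
    (h : i ≠ β) : b.IsPos (act (refl P β) i) :=
  hi.reflectionPerm hβ h

theorem isPos_act_refl_iff {b : P.Base} {i : ι} {β : ι} (hβ : β ∈ b.support)
    (h : i ≠ β) (h' : act (refl P β) i ≠ β) : b.IsPos (act (refl P β) i) ↔ b.IsPos i := by
  refine ⟨fun hi => ?_, fun hi => isPos_act_refl hβ hi h⟩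
  have := isPos_act_refl hβ hi h'
  rwa [act_refl_refl] at this

/-! ### Length and simple Hecke products -/

/-- Because s_β permutes the positive roots other than β, I(u s_β) is the disjoint union of {β} and
s_β I(u). -/
theorem length_mul_refl_of_isPos {b : P.Base} {u : P.weylGroup} {β : ι} (hβ : β ∈ b.support)
    (h : b.IsPos (act u β)) : length b (u * refl P β) = length b u + 1 := by
  have hβpos := b.isPos_of_mem_support hβ
  have hset : inversions b (u * refl P β) =
      insert β (act (refl P β) '' inversions b u) := by
    ext i
    constructor
    · rintro ⟨hi, hi'⟩
      change ¬ b.IsPos (act (u * refl P β) i) at hi'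
      rw [act_mul] at hi'
      by_cases hiβ : i = β
      · exact Or.inl hiβ
      · exact Or.inr ⟨act (refl P β) i, ⟨isPos_act_refl hβ hi hiβ, hi'⟩, act_refl_refl i β⟩
    · rintro (rfl | ⟨j, ⟨hj, hj'⟩, rfl⟩)
      · refine ⟨hβpos, ?_⟩
        change ¬ b.IsPos (act (u * refl P i) i)
        rw [act_mul, isPos_act_refl_self]
        exact not_not.mpr h
      · change ¬ b.IsPos (act u j) at hj'
        refine ⟨isPos_act_refl hβ hj ?_, ?_⟩
        · rintro rfl
          exact hj' h
        · change ¬ b.IsPos (act (u * refl P β) _)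
          rwa [act_mul, act_refl_refl]
  have hnot : β ∉ act (refl P β) '' inversions b u := by
    rintro ⟨j, ⟨hj, -⟩, hjβ⟩
    have : j = act (refl P β) β := eq_act_refl_self hjβ
    rw [this, isPos_of_root_eq_neg (root_act_refl_self β)] at hj
    exact hj hβpos
  have hinj : Function.Injective (act (refl P β)) := fun i j hij => by
    rw [← act_refl_refl (P := P) i β, hij, act_refl_refl]
  rw [length, hset, Set.ncard_insert_of_notMem hnot (Set.toFinite _),
    Set.ncard_image_of_injective _ hinj, length]

theorem length_lt_mul_refl_iff {b : P.Base} {u : P.weylGroup} {β : ι} (hβ : β ∈ b.support) :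
    length b u < length b (u * refl P β) ↔ b.IsPos (act u β) := by
  constructor
  · intro h
    by_contra h'
    have := length_mul_refl_of_isPos (u := u * refl P β) hβ
      (by rw [act_mul, isPos_act_refl_self]; exact h')
    rw [mul_refl_mul_refl] at this
    omega
  · intro h
    rw [length_mul_refl_of_isPos hβ h]
    omega

theorem heckeSimple_of_isPos {b : P.Base} {u : P.weylGroup} {β : b.support}
    (h : b.IsPos (act u β)) : heckeSimple b u β = u * refl P β :=
  if_pos ((length_lt_mul_refl_iff β.2).mpr h)

theorem heckeSimple_of_not_isPos {b : P.Base} {u : P.weylGroup} {β : b.support}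
    (h : ¬ b.IsPos (act u β)) : heckeSimple b u β = u :=
  if_neg (mt (length_lt_mul_refl_iff β.2).mp h)

theorem not_isPos_act_heckeSimple (b : P.Base) (u : P.weylGroup) (β : b.support) :
    ¬ b.IsPos (act (heckeSimple b u β) β) := by
  by_cases h : b.IsPos (act u β)
  · rw [heckeSimple_of_isPos h, act_mul, isPos_act_refl_self]
    exact not_not.mpr h
  · rwa [heckeSimple_of_not_isPos h]

/-! ### Words -/

/-- Exchange condition. Applying the letters to β from right to left, some letter α first makes the
root negative, so the root just before is α itself; deleting that letter multiplies the word by s_β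
on the right. The result is a sublist, so it uses no new letters. -/
theorem exists_sublist_wordProd_mul_refl (b : P.Base) {β : ι} (hβ : β ∈ b.support)
    (l : List b.support) (h : ¬ b.IsPos (act (wordProd b l) β)) :
    ∃ l', l'.Sublist l ∧ l'.length < l.length ∧ wordProd b l' = wordProd b l * refl P β := by
  induction l with
  | nil =>
    rw [wordProd_nil, act_one] at h
    exact absurd (b.isPos_of_mem_support hβ) h
  | cons α m ih =>
    by_cases hm : b.IsPos (act (wordProd b m) β)
    · have hα : act (wordProd b m) β = α := by
        by_contra hne
        apply h
        rw [wordProd_cons, act_mul]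
        exact isPos_act_refl α.2 hm hne
      refine ⟨m, List.sublist_cons_self _ _, by simp, ?_⟩
      rw [wordProd_cons, ← hα, refl_act, inv_mul_cancel_right, mul_refl_mul_refl]
    · obtain ⟨l', h₁, h₂, h₃⟩ := ih hm
      refine ⟨α :: l', h₁.cons_cons α, by simpa using h₂, ?_⟩
      rw [wordProd_cons, wordProd_cons, h₃, mul_assoc]

/-- If a step failed to increase length, the exchange condition would give a shorter word.
Minimality is required only among words in S: S is everything for reduced expressions and Δ_P for
elements of W_P, so it need not be known that reduced words of elements of W_P stay in Δ_P. -/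
theorem foldl_heckeSimple_of_minimal (b : P.Base) (S : Set ι) (l : List b.support)
    (hl : ∀ x ∈ l, (x : ι) ∈ S)
    (hmin : ∀ l' : List b.support, (∀ x ∈ l', (x : ι) ∈ S) → wordProd b l' = wordProd b l →
      l.length ≤ l'.length) :
    l.foldl (heckeSimple b) 1 = wordProd b l := by
  induction l using List.reverseRecOn with
  | nil => rfl
  | append_singleton l β ih =>
    have hlS : ∀ x ∈ l, (x : ι) ∈ S := fun x hx => hl x (by simp [hx])
    have hβS : (β : ι) ∈ S := hl β (by simp)
    have hl' : l.foldl (heckeSimple b) 1 = wordProd b l := by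
      refine ih hlS fun l' hl' h => ?_
      have := hmin (l' ++ [β]) (by
        intro x hx
        rcases List.mem_append.mp hx with hx | hx
        · exact hl' x hx
        · rw [List.mem_singleton.mp hx]; exact hβS) (by rw [wordProd_concat, wordProd_concat, h])
      simpa using this
    rw [List.foldl_append, hl', List.foldl_cons, List.foldl_nil, wordProd_concat]
    refine heckeSimple_of_isPos ?_
    by_contra hneg
    obtain ⟨m, h₁, h₂, h₃⟩ := exists_sublist_wordProd_mul_refl b β.2 l hneg
    have := hmin m (fun x hx => hlS x (h₁.subset hx)) (by rw [h₃, wordProd_concat])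
    simp at this
    omega

theorem IsReducedExpr.foldl_heckeSimple {b : P.Base} {w : P.weylGroup} {l : List b.support}
    (h : IsReducedExpr b w l) : l.foldl (heckeSimple b) 1 = w := by
  rw [foldl_heckeSimple_of_minimal b Set.univ l (fun _ _ => trivial)
    (fun l' _ h' => h.2 l' (h'.trans h.1)), h.1]

theorem exists_foldl_eq_of_mem_parabolic {b : P.Base} {J : Set ι} (hJ : J ⊆ b.support)
    {w : P.weylGroup} (hw : w ∈ parabolic P J) :
    ∃ l : List b.support, (∀ x ∈ l, (x : ι) ∈ J) ∧ l.foldl (heckeSimple b) 1 = w := by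
  have hex : ∃ l : List b.support, (∀ x ∈ l, (x : ι) ∈ J) ∧ wordProd b l = w := by
    induction hw using Subgroup.closure_induction with
    | mem x hx =>
      obtain ⟨i, hi, rfl⟩ := hx
      exact ⟨[⟨i, hJ hi⟩], by simpa using hi, by simp [wordProd]⟩
    | one => exact ⟨[], by simp, rfl⟩
    | mul x y _ _ hx hy =>
      obtain ⟨l, hl, rfl⟩ := hx
      obtain ⟨m, hm, rfl⟩ := hy
      refine ⟨l ++ m, fun x hx => ?_, wordProd_append b l m⟩
      exact (List.mem_append.mp hx).elim (hl x) (hm x)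
    | inv x _ hx =>
      obtain ⟨l, hl, rfl⟩ := hx
      refine ⟨l.reverse, by simpa using hl, ?_⟩
      clear hl
      rename_i hmem
      clear hmem
      induction l with
      | nil => simp [wordProd_nil]
      | cons α l ih =>
        rw [List.reverse_cons, wordProd_concat, ih, wordProd_cons, mul_inv_rev, refl_inv]
  classical
  have hn : ∃ n, ∃ l : List b.support, ((∀ x ∈ l, (x : ι) ∈ J) ∧ wordProd b l = w) ∧
      l.length = n := hex.elim fun l hl => ⟨_, l, hl, rfl⟩
  obtain ⟨l, ⟨hl, hlw⟩, hlen⟩ := Nat.find_spec hn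
  refine ⟨l, hl, ?_⟩
  rw [foldl_heckeSimple_of_minimal b J l hl, hlw]
  intro l' hl' h
  rw [hlen]
  exact Nat.find_min' hn ⟨l', ⟨hl', h.trans hlw⟩, rfl⟩

/-! ### The Hecke product -/

/-- The Hecke product `s_α · u` for a simple root `α`. -/
def simpleHecke (b : P.Base) (α : b.support) (u : P.weylGroup) : P.weylGroup :=
  (heckeSimple b u⁻¹ α)⁻¹

theorem simpleHecke_of_isPos {b : P.Base} {u : P.weylGroup} {α : b.support}
    (h : b.IsPos (act u⁻¹ α)) : simpleHecke b α u = refl P α * u := by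
  rw [simpleHecke, heckeSimple_of_isPos h, mul_inv_rev, inv_inv, refl_inv]

theorem simpleHecke_of_not_isPos {b : P.Base} {u : P.weylGroup} {α : b.support}
    (h : ¬ b.IsPos (act u⁻¹ α)) : simpleHecke b α u = u := by
  rw [simpleHecke, heckeSimple_of_not_isPos h, inv_inv]

/-- If u⁻¹α = ±β then s_α u = u s_β: for the sign + either order yields u s_β, for the sign −
nothing changes. Otherwise multiplying on one side does not affect the positivity test on the other.
-/
theorem heckeSimple_simpleHecke (b : P.Base) (α β : b.support) (u : P.weylGroup) :
    heckeSimple b (simpleHecke b α u) β = simpleHecke b α (heckeSimple b u β) := by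
  have hα := b.isPos_of_mem_support α.2
  have hβ := b.isPos_of_mem_support β.2
  by_cases h₁ : act u⁻¹ α = β
  · have h₂ : act u β = α := by rw [← h₁, act_act_inv]
    have h₃ : refl P α * u = u * refl P β := by rw [← h₂, refl_act, inv_mul_cancel_right]
    have h₄ : (u * refl P β)⁻¹ = refl P β * u⁻¹ := by rw [mul_inv_rev, refl_inv]
    rw [simpleHecke_of_isPos (by rwa [h₁]), heckeSimple_of_isPos (u := u) (by rwa [h₂]), h₃,
      heckeSimple_of_not_isPos, simpleHecke_of_not_isPos]
    · rw [h₄, act_mul, h₁, isPos_of_root_eq_neg (root_act_refl_self _)]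
      exact not_not.mpr hβ
    · rw [act_mul, isPos_act_refl_self, h₂]
      exact not_not.mpr hα
  by_cases h₂ : act (refl P β) (act u⁻¹ α) = β
  · have h₃ : act u⁻¹ α = act (refl P β) β := eq_act_refl_self h₂
    have h₄ : ¬ b.IsPos (act u⁻¹ α) := by
      rw [h₃, isPos_of_root_eq_neg (root_act_refl_self _)]
      exact not_not.mpr hβ
    have h₅ : ¬ b.IsPos (act u β) := by
      rw [← isPos_act_refl_self, ← h₃, act_act_inv]
      exact hα
    rw [simpleHecke_of_not_isPos h₄, heckeSimple_of_not_isPos h₅, simpleHecke_of_not_isPos h₄]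
  have hinv : (u * refl P β)⁻¹ = refl P β * u⁻¹ := by rw [mul_inv_rev, refl_inv]
  have h₃ : b.IsPos (act (u * refl P β)⁻¹ α) ↔ b.IsPos (act u⁻¹ α) := by
    rw [hinv, act_mul]
    exact isPos_act_refl_iff β.2 h₁ h₂
  have h₄ : b.IsPos (act (refl P α * u) β) ↔ b.IsPos (act u β) := by
    rw [act_mul]
    refine isPos_act_refl_iff α.2 ?_ ?_
    · intro h
      exact h₁ (by rw [← h, act_inv_act])
    · intro h
      apply h₂
      have h' : act u β = act (refl P α) α := eq_act_refl_self h
      have h'' : act u⁻¹ (act (refl P α) α) = β := by rw [← h', act_inv_act]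
      have h₅ : act u⁻¹ α = act (refl P β) β := by
        apply P.root.injective
        rw [root_act_refl_self, ← h'', root_act_neg _ (root_act_refl_self _), neg_neg]
      rw [h₅, act_refl_refl]
  by_cases hL : b.IsPos (act u⁻¹ α) <;> by_cases hR : b.IsPos (act u β)
  · rw [simpleHecke_of_isPos hL, heckeSimple_of_isPos (h₄.mpr hR), heckeSimple_of_isPos hR,
      simpleHecke_of_isPos (h₃.mpr hL), mul_assoc]
  · rw [simpleHecke_of_isPos hL, heckeSimple_of_not_isPos (mt h₄.mp hR),
      heckeSimple_of_not_isPos hR, simpleHecke_of_isPos hL]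
  · rw [simpleHecke_of_not_isPos hL, heckeSimple_of_isPos hR,
      simpleHecke_of_not_isPos (mt h₃.mp hL)]
  · rw [simpleHecke_of_not_isPos hL, heckeSimple_of_not_isPos hR, simpleHecke_of_not_isPos hL]

omit [Finite ι] [P.IsCrystallographic] [P.IsReduced] in
theorem foldl_heckeSimple_of_commute {b : P.Base} {F : P.weylGroup → P.weylGroup}
    (hF : ∀ x β, heckeSimple b (F x) β = F (heckeSimple b x β)) (l : List b.support)
    (x : P.weylGroup) : l.foldl (heckeSimple b) (F x) = F (l.foldl (heckeSimple b) x) := by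
  induction l generalizing x with
  | nil => rfl
  | cons β l ih => rw [List.foldl_cons, List.foldl_cons, hF, ih]

/-- F is left Hecke multiplication by u, built from left simple products along a reduced word of
u⁻¹. It moves any computation starting at u to one starting at 1. -/
theorem exists_commute_heckeSimple (b : P.Base) (u : P.weylGroup) :
    ∃ F : P.weylGroup → P.weylGroup,
      (∀ x β, heckeSimple b (F x) β = F (heckeSimple b x β)) ∧ F 1 = u := by
  have key : ∀ l : List b.support, ∃ F : P.weylGroup → P.weylGroup,
      (∀ x β, heckeSimple b (F x) β = F (heckeSimple b x β)) ∧
        F 1 = (l.foldl (heckeSimple b) 1)⁻¹ := by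
    intro l
    induction l using List.reverseRecOn with
    | nil => exact ⟨id, fun _ _ => rfl, by simp⟩
    | append_singleton l α ih =>
      obtain ⟨F, hF, hF₁⟩ := ih
      refine ⟨fun x => simpleHecke b α (F x), fun x β => ?_, ?_⟩
      · rw [heckeSimple_simpleHecke, hF]
      · change simpleHecke b α (F 1) = _
        rw [hF₁, simpleHecke, inv_inv, List.foldl_append, List.foldl_cons, List.foldl_nil]
  obtain ⟨l, hl⟩ := exists_isReducedExpr b u⁻¹
  obtain ⟨F, hF, hF₁⟩ := key l
  exact ⟨F, hF, by rw [hF₁, hl.foldl_heckeSimple, inv_inv]⟩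

/-- Independence of the word: l need not be reduced, it only has to have Hecke product v. -/
theorem hecke_eq_foldl {b : P.Base} (u : P.weylGroup) {v : P.weylGroup} {l : List b.support}
    (hl : l.foldl (heckeSimple b) 1 = v) : hecke b u v = l.foldl (heckeSimple b) u := by
  obtain ⟨F, hF, rfl⟩ := exists_commute_heckeSimple b u
  rw [hecke, foldl_heckeSimple_of_commute hF, foldl_heckeSimple_of_commute hF,
    (exists_isReducedExpr b v).choose_spec.foldl_heckeSimple, hl]

theorem heckeSimple_hecke (b : P.Base) (u v : P.weylGroup) (β : b.support) :
    heckeSimple b (hecke b u v) β = hecke b u (heckeSimple b v β) := by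
  have hl := (exists_isReducedExpr b v).choose_spec.foldl_heckeSimple
  rw [hecke_eq_foldl u hl, hecke_eq_foldl u (l := (exists_isReducedExpr b v).choose ++ [β])
    (by rw [List.foldl_append, hl]; rfl), List.foldl_append]
  rfl

theorem hecke_assoc (b : P.Base) (u v w : P.weylGroup) :
    hecke b (hecke b u v) w = hecke b u (hecke b v w) :=
  foldl_heckeSimple_of_commute (fun x β => heckeSimple_hecke b u x β) _ v

theorem one_hecke (b : P.Base) (v : P.weylGroup) : hecke b 1 v = v :=
  (exists_isReducedExpr b v).choose_spec.foldl_heckeSimple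

theorem hecke_one (b : P.Base) (u : P.weylGroup) : hecke b u 1 = u :=
  hecke_eq_foldl (l := []) u rfl

/-- `heckePow` adds factors on the right, while greedy decompositions are multiplied up from the
left. -/
theorem hecke_heckePow (b : P.Base) (x : P.weylGroup) (n : ℕ) :
    hecke b x (heckePow b x n) = heckePow b x (n + 1) := by
  induction n with
  | zero => rw [heckePow, heckePow, heckePow, hecke_one, one_hecke]
  | succ n ih => rw [heckePow, ← hecke_assoc, ih, ← heckePow]

end WeylHecke

/-! ### The parabolic subgroup W_P, its longest element and coset representatives. -/

section Parabolic

variable {ι M N : Type*} [AddCommGroup M] [Module ℝ M] [AddCommGroup N] [Module ℝ N]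
variable {P : RootPairing ι ℝ M N} {b : P.Base} {J : Set ι}

theorem root_act_sub_mem {w : P.weylGroup} [P.IsCrystallographic] (hw : w ∈ parabolic P J) :
    ∀ i, P.root (act w i) - P.root i ∈ AddSubgroup.closure (P.root '' J) := by
  induction hw using Subgroup.closure_induction with
  | mem x hx =>
    obtain ⟨j, hj, rfl⟩ := hx
    intro i
    rw [act_refl, root_reflectionPerm, reflection_apply_root' ℤ, sub_sub_cancel_left]
    exact neg_mem (zsmul_mem (AddSubgroup.subset_closure (Set.mem_image_of_mem _ hj)) _)
  | one => simp [act_one]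
  | mul x y _ _ hx hy =>
    intro i
    rw [act_mul, ← sub_add_sub_cancel _ (P.root (act y i))]
    exact add_mem (hx _) (hy _)
  | inv x _ hx =>
    intro i
    have := neg_mem (hx (act x⁻¹ i))
    rwa [act_act_inv, neg_sub] at this

theorem coroot_act_sub_mem {w : P.weylGroup} [P.IsCrystallographic] (hw : w ∈ parabolic P J) :
    ∀ i, P.coroot (act w i) - P.coroot i ∈ AddSubgroup.closure (P.coroot '' J) := by
  induction hw using Subgroup.closure_induction with
  | mem x hx =>
    obtain ⟨j, hj, rfl⟩ := hx
    intro i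
    have h : P.coroot (P.reflectionPerm j i) = P.coroot i - P.pairingIn ℤ j i • P.coroot j := by
      have := P.flip.reflection_apply_root' ℤ (i := j) (j := i)
      rw [← root_reflectionPerm] at this
      exact this
    rw [act_refl, h, sub_sub_cancel_left]
    exact neg_mem (zsmul_mem (AddSubgroup.subset_closure (Set.mem_image_of_mem _ hj)) _)
  | one => simp [act_one]
  | mul x y _ _ hx hy =>
    intro i
    rw [act_mul, ← sub_add_sub_cancel _ (P.coroot (act y i))]
    exact add_mem (hx _) (hy _)
  | inv x _ hx =>
    intro i
    have := neg_mem (hx (act x⁻¹ i))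
    rwa [act_act_inv, neg_sub] at this

/-- The functional that vanishes on J and is 1 on the other simple roots is positive on any
non-negative combination involving a simple root outside J, but zero on the lattice of J. -/
theorem mem_closure_image_of_mem [P.IsRootSystem] {x : M}
    (hx : x ∈ AddSubmonoid.closure (P.root '' b.support)) (hJ : J ⊆ b.support)
    (hx' : x ∈ AddSubgroup.closure (P.root '' J)) : x ∈ AddSubmonoid.closure (P.root '' J) := by
  classical
  set f : M →ₗ[ℝ] ℝ := b.toWeightBasis.constr ℝ fun i => if (i : ι) ∈ J then (0 : ℝ) else 1 with hf
  have hroot : ∀ i ∈ b.support, f (P.root i) = if i ∈ J then (0 : ℝ) else 1 := by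
    intro i hi
    have := b.toWeightBasis.constr_basis ℝ (fun i => if (i : ι) ∈ J then (0 : ℝ) else 1) ⟨i, hi⟩
    rwa [Base.toWeightBasis_apply] at this
  have hzero : f x = 0 := by
    clear hx
    induction hx' using AddSubgroup.closure_induction with
    | mem y hy =>
      obtain ⟨i, hi, rfl⟩ := hy
      rw [hroot i (hJ hi), if_pos hi]
    | zero => exact map_zero f
    | add y z _ _ hy hz => rw [map_add, hy, hz, add_zero]
    | neg y _ hy => rw [map_neg, hy, neg_zero]
  have key : ∀ y ∈ AddSubmonoid.closure (P.root '' b.support),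
      (y ∈ AddSubmonoid.closure (P.root '' J) ∧ f y = 0) ∨ 0 < f y := by
    intro y hy
    induction hy using AddSubmonoid.closure_induction with
    | mem y hy =>
      obtain ⟨i, hi, rfl⟩ := hy
      rw [hroot i hi]
      by_cases hiJ : i ∈ J
      · exact Or.inl ⟨AddSubmonoid.subset_closure ⟨i, hiJ, rfl⟩, if_pos hiJ⟩
      · exact Or.inr (by rw [if_neg hiJ]; exact one_pos)
    | zero => exact Or.inl ⟨zero_mem _, map_zero f⟩
    | add y z _ _ hy hz =>
      rw [map_add]
      rcases hy with ⟨hy, hy'⟩ | hy <;> rcases hz with ⟨hz, hz'⟩ | hz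
      · exact Or.inl ⟨add_mem hy hz, by rw [hy', hz', add_zero]⟩
      · exact Or.inr (by linarith)
      · exact Or.inr (by linarith)
      · exact Or.inr (by linarith)
  rcases key x hx with h | h
  · exact h.1
  · exact absurd hzero h.ne'

variable [Finite ι] [P.IsCrystallographic] [P.IsReduced]

omit [P.IsReduced] in
theorem neg_smul_mem_closure {x : P.weylGroup} (hx : ∀ β ∈ J, ¬ b.IsPos (act x β)) {y : M}
    (hy : y ∈ AddSubmonoid.closure (P.root '' J)) :
    -(x • y) ∈ AddSubmonoid.closure (P.root '' b.support) := by
  induction hy using AddSubmonoid.closure_induction with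
  | mem y hy =>
    obtain ⟨i, hi, rfl⟩ := hy
    rw [← root_act]
    exact neg_root_mem_closure (hx i hi)
  | zero => simp
  | add y z _ _ hy hz =>
    rw [smul_add, neg_add]
    exact add_mem hy hz

omit [P.IsReduced] in
theorem not_isPos_act_of_mem_posRootsOf [P.IsRootSystem] (hJ : J ⊆ b.support) {x : P.weylGroup}
    (hx : ∀ β ∈ J, ¬ b.IsPos (act x β)) {i : ι} (hi : i ∈ posRootsOf b J) :
    ¬ b.IsPos (act x i) := by
  rw [not_isPos_iff_neg_root_mem, root_act]
  exact neg_smul_mem_closure hx (mem_closure_image_of_mem (root_mem_closure hi.1) hJ hi.2)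

/-- An element having all of `J` among its right descents is determined by its coset. -/
theorem eq_of_forall_not_isPos [P.IsRootSystem] (hJ : J ⊆ b.support) {x y : P.weylGroup}
    (hx : ∀ β ∈ J, ¬ b.IsPos (act x β)) (hy : ∀ β ∈ J, ¬ b.IsPos (act y β))
    (hxy : x⁻¹ * y ∈ parabolic P J) : x = y := by
  -- If v = x⁻¹y ≠ 1, the last letter β of a word for v in J satisfies vβ < 0, and −vβ lies in R_P⁺.
  -- Since x makes R_P⁺ negative, yβ = xvβ is positive, contradicting `hy`.
  obtain ⟨l, hl, hlw⟩ := exists_foldl_eq_of_mem_parabolic hJ hxy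
  rcases List.eq_nil_or_concat' l with rfl | ⟨l, β, rfl⟩
  · exact inv_mul_eq_one.mp hlw.symm
  · exfalso
    have hβ : (β : ι) ∈ J := hl β (by simp)
    have hneg : ¬ b.IsPos (act (x⁻¹ * y) β) := by
      rw [← hlw, List.foldl_append]
      exact not_isPos_act_heckeSimple b _ β
    have hlat : P.root (act (x⁻¹ * y) β) ∈ AddSubgroup.closure (P.root '' J) := by
      rw [← sub_add_cancel (P.root (act (x⁻¹ * y) β)) (P.root β)]
      exact add_mem (root_act_sub_mem hxy β) (AddSubgroup.subset_closure ⟨_, hβ, rfl⟩)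
    set i := act (x⁻¹ * y) β with hi
    have hmem : act (refl P i) i ∈ posRootsOf b J := by
      refine ⟨(isPos_of_root_eq_neg (root_act_refl_self i)).mpr hneg, ?_⟩
      rw [root_act_refl_self]
      exact neg_mem hlat
    have h := not_isPos_act_of_mem_posRootsOf hJ hx hmem
    rw [isPos_act_refl_self, not_not, hi, ← act_mul, mul_inv_cancel_left] at h
    exact hy β hβ h

omit [P.IsCrystallographic] [P.IsReduced] in
theorem longest_mem (b : P.Base) (J : Set ι) : longest b J ∈ parabolic P J :=
  (exists_longest b J).choose_spec.1

theorem not_isPos_act_longest (hJ : J ⊆ b.support) {β : ι} (hβ : β ∈ J) :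
    ¬ b.IsPos (act (longest b J) β) := by
  intro h
  have h₁ := length_mul_refl_of_isPos (hJ hβ) h
  have h₂ := (exists_longest b J).choose_spec.2 _
    (mul_mem (longest_mem b J) (Subgroup.subset_closure ⟨β, hβ, rfl⟩))
  change length b (longest b J * refl P β) ≤ length b (longest b J) at h₂
  omega

/-- For i in R_P⁺ the root p⁻¹i lies in ℤΔ_P and must be negative, as p makes R_P⁺ negative. So x,
which also makes R_P⁺ negative, sends p⁻¹i to a positive root. -/
theorem mul_longest_inv_mem_minimalReps [P.IsRootSystem] (hJ : J ⊆ b.support) {x : P.weylGroup}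
    (hx : ∀ β ∈ J, ¬ b.IsPos (act x β)) : x * (longest b J)⁻¹ ∈ minimalReps b J := by
  refine Set.eq_empty_of_forall_notMem ?_
  rintro i ⟨⟨hi, hi'⟩, hiJ⟩
  set p := longest b J
  change ¬ b.IsPos (act (x * p⁻¹) i) at hi'
  rw [act_mul] at hi'
  have hlat : P.root (act p⁻¹ i) ∈ AddSubgroup.closure (P.root '' J) := by
    rw [← sub_add_cancel (P.root (act p⁻¹ i)) (P.root i)]
    exact add_mem (root_act_sub_mem (inv_mem (longest_mem b J)) i) hiJ.2
  by_cases hpos : b.IsPos (act p⁻¹ i)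
  · have := not_isPos_act_of_mem_posRootsOf hJ (x := p)
      (fun β hβ => not_isPos_act_longest hJ hβ) ⟨hpos, hlat⟩
    rw [act_act_inv] at this
    exact this hi
  · set j := act p⁻¹ i
    have hmem : act (refl P j) j ∈ posRootsOf b J := by
      refine ⟨(isPos_of_root_eq_neg (root_act_refl_self j)).mpr hpos, ?_⟩
      rw [root_act_refl_self]
      exact neg_mem hlat
    have h := not_isPos_act_of_mem_posRootsOf hJ hx hmem
    rw [isPos_act_refl_self] at h
    exact h hi'

theorem hecke_longest_descent (hJ : J ⊆ b.support) (u : P.weylGroup) {β : ι} (hβ : β ∈ J) :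
    ¬ b.IsPos (act (hecke b u (longest b J)) β) := by
  have h : heckeSimple b (longest b J) ⟨β, hJ hβ⟩ = longest b J :=
    heckeSimple_of_not_isPos (not_isPos_act_longest hJ hβ)
  rw [← h, ← heckeSimple_hecke]
  exact not_isPos_act_heckeSimple b _ ⟨β, hJ hβ⟩

theorem inv_mul_foldl_mem_parabolic (u : P.weylGroup) (l : List b.support)
    (hl : ∀ x ∈ l, (x : ι) ∈ J) : u⁻¹ * l.foldl (heckeSimple b) u ∈ parabolic P J := by
  induction l generalizing u with
  | nil => simp
  | cons β l ih =>
    have h := ih (heckeSimple b u β) fun x hx => hl x (by simp [hx])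
    rw [List.foldl_cons]
    by_cases hu : b.IsPos (act u β)
    · rw [heckeSimple_of_isPos hu] at h ⊢
      have := mul_mem (Subgroup.subset_closure ⟨β, hl β (by simp), rfl⟩ :
        refl P β ∈ parabolic P J) h
      rwa [mul_inv_rev, mul_assoc, mul_inv_cancel_left] at this
    · rwa [heckeSimple_of_not_isPos hu] at h ⊢

theorem inv_mul_hecke_mem_parabolic (hJ : J ⊆ b.support) (u : P.weylGroup) {v : P.weylGroup}
    (hv : v ∈ parabolic P J) : u⁻¹ * hecke b u v ∈ parabolic P J := by
  obtain ⟨l, hl, hlv⟩ := exists_foldl_eq_of_mem_parabolic hJ hv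
  rw [hecke_eq_foldl u hlv]
  exact inv_mul_foldl_mem_parabolic u l hl

/-- Both sides lie in the same coset and have all of J as right descents, which pins down a single
element. -/
theorem hecke_longest_congr [P.IsRootSystem] (hJ : J ⊆ b.support) {u v : P.weylGroup}
    (h : u⁻¹ * v ∈ parabolic P J) : hecke b u (longest b J) = hecke b v (longest b J) := by
  refine eq_of_forall_not_isPos hJ (fun β => hecke_longest_descent hJ u)
    (fun β => hecke_longest_descent hJ v) ?_
  have h₁ := inv_mem (inv_mul_hecke_mem_parabolic (b := b) hJ u (longest_mem b J))
  have h₂ := inv_mul_hecke_mem_parabolic (b := b) hJ v (longest_mem b J)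
  have := mul_mem (mul_mem h₁ h) h₂
  convert this using 1
  group

theorem longest_hecke_longest [P.IsRootSystem] (hJ : J ⊆ b.support) :
    hecke b (longest b J) (longest b J) = longest b J := by
  have := hecke_longest_congr (b := b) hJ (u := longest b J) (v := 1)
    (by simpa using longest_mem b J)
  rwa [one_hecke] at this

/-- If `s_θ = w_P s_γ w_P⁻¹` with `w_P γ > 0`, then
`s_θ · … · s_θ · w_P = (w_P s_γ) · … · (w_P s_γ) · w_P`. -/
theorem foldr_hecke_replicate [P.IsRootSystem] (hJ : J ⊆ b.support) (γ : b.support)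
    (hγ : b.IsPos (act (longest b J) γ)) (n : ℕ) :
    (List.replicate n (act (longest b J) γ)).foldr (fun i v => hecke b (refl P i) v)
        (longest b J) =
      hecke b (heckePow b (longest b J * refl P γ) n) (longest b J) := by
  set p := longest b J with hp
  set a := p * refl P γ with ha
  set s := refl P (act p γ) with hs
  have hpp : hecke b p p = p := longest_hecke_longest hJ
  -- Since pγ > 0, the product a = p s_γ is also the Hecke product p · s_γ, so p · p = p gives the
  -- claim.
  have hpa : hecke b p a = a := by
    rw [ha, ← heckeSimple_of_isPos hγ, ← heckeSimple_hecke, hpp]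
  have hsp : hecke b s p = hecke b a p := by
    refine hecke_longest_congr hJ ?_
    rw [hs, refl_act, ha]
    have := longest_mem b J
    rw [← hp] at this
    convert this using 1
    group
  -- Left absorption of p is carried along the induction: it allows inserting p after s, replacing s
  -- · p by a · p, and removing p again.
  suffices h : ∀ n, (List.replicate n (act p γ)).foldr (fun i v => hecke b (refl P i) v) p =
      hecke b (heckePow b a n) p ∧
      hecke b p (hecke b (heckePow b a n) p) = hecke b (heckePow b a n) p from (h n).1
  intro n
  induction n with
  | zero => exact ⟨by simp [heckePow, one_hecke], by rw [heckePow, one_hecke, hpp]⟩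
  | succ n ih =>
    constructor
    · rw [List.replicate_succ, List.foldr_cons, ih.1, ← ih.2, ← hs, ← hecke_assoc, hsp,
        hecke_assoc, ih.2, ← hecke_assoc, hecke_heckePow]
    · rw [← hecke_heckePow, ← hecke_assoc, ← hecke_assoc, hpa]

end Parabolic

/-! ### Coefficients of γ, degrees, and the highest root. -/

section Cominuscule

variable {ι M N : Type*} [AddCommGroup M] [Module ℝ M] [AddCommGroup N] [Module ℝ N]
variable {P : RootPairing ι ℝ M N} [P.IsRootSystem] {b : P.Base} {γ : b.support}

theorem coord_eq_zero_of_mem {y : M}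
    (hy : y ∈ AddSubgroup.closure (P.root '' ((b.support : Set ι) \ {(γ : ι)}))) :
    b.toWeightBasis.coord γ y = 0 := by
  induction hy using AddSubgroup.closure_induction with
  | mem y hy =>
    obtain ⟨i, ⟨hi, hiγ⟩, rfl⟩ := hy
    have hne : (⟨i, hi⟩ : b.support) ≠ γ := fun h => hiγ (congrArg Subtype.val h)
    rw [Module.Basis.coord_apply, b.toWeightBasis_repr_root ⟨i, hi⟩, Finsupp.single_eq_of_ne' hne]
  | zero => exact map_zero _
  | add y z _ _ hy hz => rw [map_add, hy, hz, add_zero]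
  | neg y _ hy => rw [map_neg, hy, neg_zero]

theorem exists_eq_nsmul_add {x : M} (hx : x ∈ AddSubmonoid.closure (P.root '' b.support)) :
    ∃ n : ℕ, ∃ y ∈ AddSubmonoid.closure (P.root '' ((b.support : Set ι) \ {(γ : ι)})),
      x = n • P.root γ + y ∧ b.toWeightBasis.coord γ x = n := by
  have h : ∃ n : ℕ, ∃ y ∈ AddSubmonoid.closure (P.root '' ((b.support : Set ι) \ {(γ : ι)})),
      x = n • P.root γ + y := by
    induction hx using AddSubmonoid.closure_induction with
    | mem y hy =>
      obtain ⟨i, hi, rfl⟩ := hy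
      by_cases hiγ : i = γ
      · exact ⟨1, 0, zero_mem _, by simp [hiγ]⟩
      · exact ⟨0, P.root i, AddSubmonoid.subset_closure ⟨i, ⟨hi, hiγ⟩, rfl⟩, by simp⟩
    | zero => exact ⟨0, 0, zero_mem _, by simp⟩
    | add y z _ _ hy hz =>
      obtain ⟨n, y, hy, rfl⟩ := hy
      obtain ⟨m, z, hz, rfl⟩ := hz
      exact ⟨n + m, y + z, add_mem hy hz, by rw [add_smul]; abel⟩
  obtain ⟨n, y, hy, rfl⟩ := h
  refine ⟨n, y, hy, rfl, ?_⟩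
  have hy' : y ∈ AddSubgroup.closure (P.root '' ((b.support : Set ι) \ {(γ : ι)})) :=
    (AddSubmonoid.closure_le (S := (AddSubgroup.closure _).toAddSubmonoid)).mpr
      AddSubgroup.subset_closure hy
  rw [map_add, coord_eq_zero_of_mem hy', add_zero, map_nsmul, Module.Basis.coord_apply,
    b.toWeightBasis_repr_root γ, Finsupp.single_eq_same, nsmul_one]

theorem RootLE.antisymm {i j : ι} (h : RootLE b i j) (h' : RootLE b j i) : i = j := by
  apply P.root.injective
  rw [eq_comm, ← sub_eq_zero]
  refine eq_zero_of_mem_closure_of_neg_mem h ?_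
  rw [neg_sub]
  exact h'

theorem IsHighestRoot.eq {i j : ι} (hi : IsHighestRoot b i) (hj : IsHighestRoot b j) : i = j :=
  (hj.2 i).antisymm (hi.2 j)

/-- The coefficient of `γ^∨` in a degree. -/
def degreeHom (b : P.Base) (γ : b.support) :
    H2 b ((b.support : Set ι) \ {(γ : ι)}) →+ ℝ :=
  QuotientAddGroup.lift _
    ((b.toCoweightBasis.coord γ).toAddMonoidHom.comp (corootLattice b).subtype) (by
      rintro ⟨x, hx⟩ hx'
      rw [AddSubgroup.mem_addSubgroupOf] at hx'
      change b.toCoweightBasis.coord γ x = 0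
      change x ∈ _ at hx'
      clear hx
      induction hx' using AddSubgroup.closure_induction with
      | mem y hy =>
        obtain ⟨i, ⟨hi, hiγ⟩, rfl⟩ := hy
        have hne : (⟨i, hi⟩ : b.support) ≠ γ := fun h => hiγ (congrArg Subtype.val h)
        rw [Module.Basis.coord_apply, b.toCoweightBasis_repr_coroot ⟨i, hi⟩,
          Finsupp.single_eq_of_ne' hne]
      | zero => exact map_zero _
      | add y z _ _ hy hz => rw [map_add, hy, hz, add_zero]
      | neg y _ hy => rw [map_neg, hy, neg_zero])

theorem degreeHom_corootClass (i : ι) :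
    degreeHom b γ (corootClass b _ i) = b.toCoweightBasis.coord γ (P.coroot i) := rfl

theorem degreeHom_corootClass_self : degreeHom b γ (corootClass b _ γ) = 1 := by
  rw [degreeHom_corootClass, Module.Basis.coord_apply, b.toCoweightBasis_repr_coroot γ,
    Finsupp.single_eq_same]

theorem degreeHom_zsmul (n : ℤ) : degreeHom b γ (n • corootClass b _ γ) = n := by
  rw [map_zsmul, degreeHom_corootClass_self, zsmul_one]

omit [P.IsRootSystem] in
theorem corootClass_eq_zero {β : ι} {J : Set ι} (hβ : β ∈ J) : corootClass b J β = 0 := by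
  rw [corootClass, QuotientAddGroup.eq_zero_iff, AddSubgroup.mem_addSubgroupOf]
  exact AddSubgroup.subset_closure ⟨β, hβ, rfl⟩

omit [P.IsRootSystem] in
theorem exists_eq_zsmul (e : H2 b ((b.support : Set ι) \ {(γ : ι)})) :
    ∃ n : ℤ, e = n • corootClass b _ γ := by
  obtain ⟨⟨x, hx⟩, rfl⟩ := QuotientAddGroup.mk_surjective e
  induction hx using AddSubgroup.closure_induction with
  | mem y hy =>
    obtain ⟨i, hi, rfl⟩ := hy
    by_cases hiγ : i = γ
    · subst hiγ
      exact ⟨1, (one_zsmul _).symm⟩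
    · exact ⟨0, by rw [zero_zsmul]; exact corootClass_eq_zero ⟨hi, hiγ⟩⟩
  | zero => exact ⟨0, by rw [zero_zsmul]; rfl⟩
  | add y z hy hz hy' hz' =>
    obtain ⟨n, hn⟩ := hy'
    obtain ⟨m, hm⟩ := hz'
    exact ⟨n + m, by rw [add_zsmul, ← hn, ← hm]; rfl⟩
  | neg y hy hy' =>
    obtain ⟨n, hn⟩ := hy'
    exact ⟨-n, by rw [neg_zsmul, ← hn]; rfl⟩

/-- All simple coroots other than γ^∨ have class zero, so the coefficient of γ^∨ is non-negative on
effective classes. -/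
theorem isEffective_zsmul_iff (n : ℤ) :
    IsEffective b ((b.support : Set ι) \ {(γ : ι)}) (n • corootClass b _ γ) ↔ 0 ≤ n := by
  constructor
  · intro h
    have key : ∀ e : H2 b ((b.support : Set ι) \ {(γ : ι)}), IsEffective b _ e →
        0 ≤ degreeHom b γ e := by
      intro e he
      induction he using AddSubmonoid.closure_induction with
      | mem y hy =>
        obtain ⟨i, hi, rfl⟩ := hy
        by_cases hiγ : i = γ
        · rw [hiγ, degreeHom_corootClass_self]
          exact zero_le_one
        · have hiJ : i ∈ (b.support : Set ι) \ {(γ : ι)} := ⟨hi, hiγ⟩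
          rw [corootClass_eq_zero hiJ, map_zero]
      | zero => rw [map_zero]
      | add y z _ _ hy hz => rw [map_add]; exact add_nonneg hy hz
    have := key _ h
    rw [degreeHom_zsmul] at this
    exact_mod_cast this
  · intro h
    lift n to ℕ using h
    rw [natCast_zsmul]
    exact nsmul_mem (AddSubmonoid.subset_closure (Set.mem_image_of_mem _ γ.2)) n

theorem degreeLE_zsmul_iff (m n : ℤ) :
    DegreeLE b ((b.support : Set ι) \ {(γ : ι)}) (m • corootClass b _ γ)
      (n • corootClass b _ γ) ↔ m ≤ n := by
  rw [DegreeLE, ← sub_smul, isEffective_zsmul_iff, sub_nonneg]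

variable [Finite ι] [P.IsCrystallographic] [P.IsReduced]

omit [P.IsRootSystem] [Finite ι] [P.IsReduced] in
theorem corootClass_act {J : Set ι} {w : P.weylGroup} (hw : w ∈ parabolic P J) (i : ι) :
    corootClass b J (act w i) = corootClass b J i := by
  rw [corootClass, corootClass, eq_comm, QuotientAddGroup.eq, AddSubgroup.mem_addSubgroupOf]
  have := coroot_act_sub_mem hw i
  rwa [sub_eq_neg_add] at this

-- Up to the invariant form, α^∨ is 2α/(α,α); comparing γ-coordinates on the basis of simple roots
-- gives the identity. It transfers positivity of the γ-coefficient from roots to coroots.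
omit [Finite ι] [P.IsCrystallographic] [P.IsReduced] in
theorem rootForm_mul_coord_coroot [Fintype ι] (i : ι) :
    P.RootForm (P.root i) (P.root i) * b.toCoweightBasis.coord γ (P.coroot i) =
      P.RootForm (P.root γ) (P.root γ) * b.toWeightBasis.coord γ (P.root i) := by
  have h : ∀ x : M, b.toCoweightBasis.coord γ (2 • P.Polarization x) =
      P.RootForm (P.root γ) (P.root γ) * b.toWeightBasis.coord γ x := by
    intro x
    have : (2 : ℕ) • ((b.toCoweightBasis.coord γ).comp P.Polarization) =
        P.RootForm (P.root γ) (P.root γ) • b.toWeightBasis.coord γ := by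
      refine b.toWeightBasis.ext fun β => ?_
      rw [b.toWeightBasis_apply]
      have h₁ : ((2 : ℕ) • ((b.toCoweightBasis.coord γ).comp P.Polarization)) (P.root β) =
          b.toCoweightBasis.coord γ (2 • P.Polarization (P.root β)) := by
        rw [map_nsmul]; rfl
      rw [h₁, ← P.rootForm_self_smul_coroot, map_smul, LinearMap.smul_apply,
        Module.Basis.coord_apply, Module.Basis.coord_apply, b.toCoweightBasis_repr_coroot β,
        b.toWeightBasis_repr_root β]
      by_cases hβ : β = γ
      · rw [hβ]
      · rw [Finsupp.single_eq_of_ne' hβ, smul_zero, smul_zero]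
    rw [map_nsmul]
    exact congrArg (fun f : M →ₗ[ℝ] ℝ => f x) this
  rw [← h, ← P.rootForm_self_smul_coroot, map_smul, smul_eq_mul]

omit [P.IsReduced] in
theorem coord_pos_of_notMem {i : ι} (hi : b.IsPos i)
    (hi' : i ∉ posRootsOf b ((b.support : Set ι) \ {(γ : ι)})) :
    0 < b.toWeightBasis.coord γ (P.root i) := by
  obtain ⟨n, y, hy, hxy, hn⟩ := exists_eq_nsmul_add (γ := γ) (root_mem_closure hi)
  rw [hn, Nat.cast_pos]
  by_contra h
  refine hi' ⟨hi, ?_⟩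
  rw [hxy, Nat.eq_zero_of_not_pos h, zero_smul, zero_add]
  exact (AddSubmonoid.closure_le (S := (AddSubgroup.closure _).toAddSubmonoid)).mpr
    AddSubgroup.subset_closure hy

-- Roots outside R_P⁺ have positive degree, so degrees n ≤ 0 have no maximal root.
omit [P.IsReduced] in
theorem exists_corootClass_eq {i : ι} (hi : b.IsPos i)
    (hi' : i ∉ posRootsOf b ((b.support : Set ι) \ {(γ : ι)})) :
    ∃ n : ℤ, 0 < n ∧ corootClass b ((b.support : Set ι) \ {(γ : ι)}) i =
      n • corootClass b _ γ := by
  cases nonempty_fintype ι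
  obtain ⟨n, hn⟩ := exists_eq_zsmul (corootClass b ((b.support : Set ι) \ {(γ : ι)}) i)
  refine ⟨n, ?_, hn⟩
  have h := congrArg (degreeHom b γ) hn
  rw [degreeHom_zsmul, degreeHom_corootClass] at h
  have hform := rootForm_mul_coord_coroot (b := b) (γ := γ) i
  have h₁ := P.rootForm_pos_of_ne_zero (Submodule.subset_span (Set.mem_range_self i)) (P.ne_zero i)
  have h₂ := P.rootForm_pos_of_ne_zero (Submodule.subset_span (Set.mem_range_self (γ : ι)))
    (P.ne_zero γ)
  have h₃ := mul_pos h₂ (coord_pos_of_notMem hi hi')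
  rw [← hform, mul_pos_iff_of_pos_left h₁, h] at h₃
  exact_mod_cast h₃

/-! ### Consequences of the coefficient of γ in the highest root being one. -/

variable {θ : ι}

/-- The γ-coefficient is invariant under W_P, so p⁻¹θ = γ + y with y in the cone of Δ_P. As py is a
non-positive combination, θ ≤ pγ. -/
theorem act_longest_eq (hθ : IsHighestRoot b θ) (hγ : b.toWeightBasis.repr (P.root θ) γ = 1) :
    act (longest b ((b.support : Set ι) \ {(γ : ι)})) γ = θ := by
  set J : Set ι := (b.support : Set ι) \ {(γ : ι)} with hJdef
  have hJ : J ⊆ b.support := Set.sdiff_subset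
  set p := longest b J with hp
  refine (hθ.2 _).antisymm ?_
  have hcoord : b.toWeightBasis.coord γ (P.root (act p⁻¹ θ)) = 1 := by
    have := coord_eq_zero_of_mem (root_act_sub_mem (inv_mem (longest_mem b J)) θ)
    rw [map_sub, sub_eq_zero] at this
    exact this.trans hγ
  have hpos : b.IsPos (act p⁻¹ θ) := by
    by_contra hneg
    obtain ⟨n, -, -, -, hn⟩ := exists_eq_nsmul_add (γ := γ) (neg_root_mem_closure hneg)
    rw [map_neg, hcoord] at hn
    have := n.cast_nonneg (α := ℝ)
    linarith
  obtain ⟨n, y, hy, hxy, hn⟩ := exists_eq_nsmul_add (γ := γ) (root_mem_closure hpos)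
  have hn1 : n = 1 := by
    rw [hcoord] at hn
    exact_mod_cast hn.symm
  have hθeq : P.root θ = P.root (act p γ) + p • y := by
    rw [← act_act_inv p θ, root_act, hxy, hn1, one_smul, smul_add, root_act]
  have h := neg_smul_mem_closure (x := p) (fun β hβ => not_isPos_act_longest hJ hβ) hy
  rw [RootLE, hθeq, sub_add_cancel_left]
  exact h

omit [Finite ι] [P.IsCrystallographic] [P.IsReduced] in
theorem notMem_posRootsOf (hγ : b.toWeightBasis.repr (P.root θ) γ = 1) :
    θ ∉ posRootsOf b ((b.support : Set ι) \ {(γ : ι)}) := by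
  intro h
  have := coord_eq_zero_of_mem h.2
  rw [Module.Basis.coord_apply, hγ] at this
  exact one_ne_zero this

theorem corootClass_eq_of_isHighestRoot (hθ : IsHighestRoot b θ)
    (hγ : b.toWeightBasis.repr (P.root θ) γ = 1) :
    corootClass b ((b.support : Set ι) \ {(γ : ι)}) θ = corootClass b _ γ := by
  rw [← act_longest_eq hθ hγ, corootClass_act (longest_mem b _)]

/-- θ has degree one, so it is admissible for every n > 0, and it dominates every other root. -/
theorem isMaximalRoot_zsmul_iff (hθ : IsHighestRoot b θ)
    (hγ : b.toWeightBasis.repr (P.root θ) γ = 1) (n : ℤ) (i : ι) :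
    IsMaximalRoot b ((b.support : Set ι) \ {(γ : ι)}) (n • corootClass b _ γ) i ↔
      0 < n ∧ i = θ := by
  have hmem : ∀ n : ℤ, 0 < n →
      θ ∈ rootsBelow b ((b.support : Set ι) \ {(γ : ι)}) (n • corootClass b _ γ) := by
    intro n hn
    refine ⟨hθ.1, notMem_posRootsOf hγ, ?_⟩
    rw [corootClass_eq_of_isHighestRoot hθ hγ, ← one_zsmul (corootClass b _ (γ : ι)),
      ← mul_zsmul, mul_one, degreeLE_zsmul_iff]
    exact hn
  constructor
  · rintro ⟨⟨hi, hi', hle⟩, hmax⟩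
    obtain ⟨m, hm, hmi⟩ := exists_corootClass_eq hi hi'
    rw [hmi, degreeLE_zsmul_iff] at hle
    have hn : 0 < n := hm.trans_le hle
    exact ⟨hn, (hmax θ (hmem n hn) (hθ.2 i)).symm⟩
  · rintro ⟨hn, rfl⟩
    exact ⟨hmem n hn, fun j _ hj => (hθ.2 j).antisymm hj⟩

theorem isPCosmall_iff (hθ : IsHighestRoot b θ)
    (hγ : b.toWeightBasis.repr (P.root θ) γ = 1) (i : ι) :
    IsPCosmall b ((b.support : Set ι) \ {(γ : ι)}) i ↔ IsHighestRoot b i := by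
  obtain ⟨n, hn⟩ := exists_eq_zsmul (corootClass b ((b.support : Set ι) \ {(γ : ι)}) i)
  rw [IsPCosmall, hn, isMaximalRoot_zsmul_iff hθ hγ]
  constructor
  · rintro ⟨-, rfl⟩
    exact hθ
  · intro hi
    obtain rfl := hi.eq hθ
    refine ⟨?_, rfl⟩
    rw [corootClass_eq_of_isHighestRoot hθ hγ] at hn
    have := congrArg (degreeHom b γ) hn
    rw [degreeHom_zsmul, degreeHom_corootClass_self] at this
    have hn1 : n = 1 := by exact_mod_cast this.symm
    omega

theorem isGreedyDecomposition_nsmul_iff (hθ : IsHighestRoot b θ)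
    (hγ : b.toWeightBasis.repr (P.root θ) γ = 1) (d : ℕ) (l : List ι) :
    IsGreedyDecomposition b ((b.support : Set ι) \ {(γ : ι)}) (d • corootClass b _ γ) l ↔
      l = List.replicate d θ := by
  have hsub : ∀ d : ℕ, (d + 1) • corootClass b ((b.support : Set ι) \ {(γ : ι)}) γ -
      corootClass b _ θ = d • corootClass b _ γ := by
    intro d
    rw [corootClass_eq_of_isHighestRoot hθ hγ, add_smul, one_smul, add_sub_cancel_right]
  constructor
  · intro h
    -- The degree index must be a variable for induction on the decomposition; `he` retains its
    -- value.
    generalize he : d • corootClass b ((b.support : Set ι) \ {(γ : ι)}) γ = e at h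
    induction h generalizing d with
    | nil =>
      have := congrArg (degreeHom b γ) he
      rw [map_nsmul, degreeHom_corootClass_self, map_zero, nsmul_one, Nat.cast_eq_zero] at this
      rw [this, List.replicate_zero]
    | cons hi _ ih =>
      subst he
      rw [← natCast_zsmul, isMaximalRoot_zsmul_iff hθ hγ] at hi
      obtain ⟨hd, rfl⟩ := hi
      obtain ⟨d, rfl⟩ := Nat.exists_eq_add_one.mpr (Int.natCast_pos.mp hd)
      rw [List.replicate_succ, ih d (hsub d).symm]
  · rintro rfl
    induction d with
    | zero =>
      have h : 0 • corootClass b ((b.support : Set ι) \ {(γ : ι)}) γ = 0 := zero_nsmul _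
      rw [h]
      exact .nil
    | succ d ih =>
      refine .cons ?_ (by rw [hsub]; exact ih)
      rw [← natCast_zsmul, isMaximalRoot_zsmul_iff hθ hγ]
      exact ⟨by positivity, rfl⟩

theorem isZ_iff (hθ : IsHighestRoot b θ) (hγ : b.toWeightBasis.repr (P.root θ) γ = 1) (d : ℕ)
    (z : P.weylGroup) :
    IsZ b ((b.support : Set ι) \ {(γ : ι)}) (d • corootClass b _ γ) z ↔
      z = hecke b (heckePow b (longest b ((b.support : Set ι) \ {(γ : ι)}) * refl P γ) d)
        (longest b ((b.support : Set ι) \ {(γ : ι)})) *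
          (longest b ((b.support : Set ι) \ {(γ : ι)}))⁻¹ := by
  have hJ : (b.support : Set ι) \ {(γ : ι)} ⊆ b.support := Set.sdiff_subset
  have hact := act_longest_eq hθ hγ
  have hfold := foldr_hecke_replicate hJ γ (by rw [hact]; exact hθ.1) d
  rw [hact] at hfold
  simp only [IsZ, isGreedyDecomposition_nsmul_iff hθ hγ, exists_eq_left, hfold,
    eq_mul_inv_iff_mul_eq]
  refine ⟨fun h => h.2, fun h => ⟨?_, h⟩⟩
  rw [eq_mul_inv_of_mul_eq h]
  exact mul_longest_inv_mem_minimalReps hJ fun β hβ => hecke_longest_descent hJ _ hβ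

end Cominuscule

end CurveNbhd

end

open CurveNbhd in
theorem mainTheorem9 {ι M N : Type*} [Finite ι] [AddCommGroup M] [Module ℝ M]
    [AddCommGroup N] [Module ℝ N] (P : RootPairing ι ℝ M N) [P.IsRootSystem]
    [P.IsCrystallographic] [P.IsReduced] (b : P.Base) (γ : b.support)
    (hγ : IsCominuscule b γ) (J : Set ι) (hJ : J = (b.support : Set ι) \ {(γ : ι)}) :
    (∀ e : H2 b J, ∃! n : ℤ, e = n • corootClass b J γ) ∧
    (∀ n : ℤ, IsEffective b J (n • corootClass b J γ) ↔ 0 ≤ n) ∧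
    (∀ i, IsPCosmall b J i ↔ IsHighestRoot b i) ∧
    ∀ d : ℕ, (∃! z, IsZ b J (d • corootClass b J γ) z) ∧
      ∀ z, IsZ b J (d • corootClass b J γ) z →
        (z : P.weylGroup ⧸ parabolic P J) =
          (heckePow b (longest b J * refl P γ) d : P.weylGroup ⧸ parabolic P J) := by
  subst hJ
  obtain ⟨θ, hθ, hθγ⟩ := hγ
  refine ⟨fun e => ?_, isEffective_zsmul_iff, isPCosmall_iff hθ hθγ, fun d => ⟨?_, fun z hz => ?_⟩⟩
  · obtain ⟨n, hn⟩ := exists_eq_zsmul e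
    refine ⟨n, hn, fun m hm => ?_⟩
    have := congrArg (degreeHom b γ) (hm.symm.trans hn)
    rw [degreeHom_zsmul, degreeHom_zsmul] at this
    exact_mod_cast this
  · exact ⟨_, (isZ_iff hθ hθγ d _).mpr rfl, fun z hz => (isZ_iff hθ hθγ d z).mp hz⟩
  -- Neither the Hecke factor p nor the ordinary factor p⁻¹ leaves the coset, as p lies in W_P.
  · rw [(isZ_iff hθ hθγ d z).mp hz, eq_comm, QuotientGroup.eq, ← mul_assoc]
    exact mul_mem (inv_mul_hecke_mem_parabolic Set.sdiff_subset _ (longest_mem b _))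
      (inv_mem (longest_mem b _))
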